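/- Let $1\le m\le n$ and let $A=(a_{i,j})$ be a complex $m\times n$ matrix that is upper-triangular ($a_{i,j}=0$ for $i>j$) and whose entries $a_{1,1},\dots,a_{m,m}$ on the first main diagonal are pairwise distinct. For $1\le s\le n-m+1$ let $J_s$ be the $m\times n$ matrix with entries $1$ at the positions $(i,j)$ with $j-i=s-1$ and $0$ elsewhere, let $\mathfrak L$ be the linear span of $J_1,\dots,J_{n-m+1}$ (the standard diagonal subspace), and let $\mathcal E\subset A+\mathfrak L$ be the eigenvalue locus of the pencil $A+\mathfrak L$, that is, the set of its members of rank less than $m$. Write $A(\lambda)=A+\lambda_1J_1+\dots+\lambda_{n-m+1}J_{n-m+1}$ for $\lambda\in\mathbb C^{n-m+1}$. For $1\le i\le m$ let $M^{(i)}=A(-a_{i,i},\lambda_2,\dots,\lambda_{n-m+1})$, a matrix over the polynomial ring $\mathbb C[\lambda_2,\dots,\lambda_{n-m+1}]$. Define polynomials $k^{(i)}_1,\dots,k^{(i)}_m$ in this ring by $k^{(i)}_l=0$ for $l<i$, $k^{(i)}_i=1$, and recursively $$k^{(i)}_l=\frac1{a_{i,i}-a_{l,l}}\sum_{p=1}^{l-1}k^{(i)}_p\,M^{(i)}_{p,l}\qquad(i<l\le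 m),$$ and put $$F^{(i)}_c=\sum_{l=1}^m k^{(i)}_l\,M^{(i)}_{l,c}\qquad(m<c\le n).$$ Let $V_i\subset\mathbb C^{n-m+1}$ be the set of all $\lambda$ with $\lambda_1=-a_{i,i}$ and $F^{(i)}_c(\lambda_2,\dots,\lambda_{n-m+1})=0$ for all $m<c\le n$. Then $$\mathcal E=\bigcup_{i=1}^m\{A(\lambda):\lambda\in V_i\},$$ and for each $i=1,\dots,m$: 1. $V_i=\{\lambda\in\mathbb C^{n-m+1}: A(\lambda)\in\mathcal E,\ \lambda_1=-a_{i,i}\}$; 2. the ideal of $\mathbb C[\lambda_2,\dots,\lambda_{n-m+1}]$ generated by the maximal minors of $M^{(i)}$ equals the ideal generated by the $n-m$ polynomials $F^{(i)}_{m+1},\dots,F^{(i)}_n$; 3. $F^{(i)}_{m+1}=\dots=F^{(i)}_n=0$ is a complete intersection: the quotient of $\mathbb C[\lambda_2,\dots,\lambda_{n-m+1}]$ by the ideal generated by these $n-m$ polynomials in $n-m$ variables is nonzero and has Krull dimension $0$. -/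

import Mathlib

noncomputable section

namespace MatrixPencil

variable {m n : ℕ}

/-- The `s`-th diagonal matrix of size `m × n` (with `s` counted from `0`): its entries are `1` on
the diagonal `j - i = s` and `0` elsewhere. -/
def diagonalMatrix (R : Type*) [CommRing R] (m n : ℕ) (s : Fin (n - m + 1)) :
    Matrix (Fin m) (Fin n) R :=
  Matrix.of fun i j => if (j : ℕ) = (i : ℕ) + (s : ℕ) then 1 else 0

/-- The standard diagonal subspace: the linear span of the `n - m + 1` diagonal matrices. -/
def standardDiagonalSubspace (m n : ℕ) : Submodule ℂ (Matrix (Fin m) (Fin n) ℂ) :=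
  Submodule.span ℂ (Set.range (diagonalMatrix ℂ m n))

/-- The eigenvalue locus of the pencil `A + L`: the matrices of the pencil of rank less than `m`. -/
def eigenvalueLocus (A : Matrix (Fin m) (Fin n) ℂ) (L : Submodule ℂ (Matrix (Fin m) (Fin n) ℂ)) :
    Set (Matrix (Fin m) (Fin n) ℂ) :=
  {M | M - A ∈ L ∧ M.rank < m}

/-- The member `A + ∑ s, lam s • J s` of the pencil with parameters `lam` in a `ℂ`-algebra `R`
(used for `R = ℂ` and for polynomial rings over `ℂ`). -/
def member {R : Type*} [CommRing R] [Algebra ℂ R] (A : Matrix (Fin m) (Fin n) ℂ)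
    (lam : Fin (n - m + 1) → R) : Matrix (Fin m) (Fin n) R :=
  A.map (algebraMap ℂ R) + ∑ s, lam s • diagonalMatrix R m n s

/-- The `i`-th entry on the first main diagonal. -/
def diagEntry (h : m ≤ n) (A : Matrix (Fin m) (Fin n) ℂ) (i : Fin m) : ℂ :=
  A i (Fin.castLE h i)

/-- The member of the pencil whose first parameter is minus the `i`-th diagonal entry, while the
remaining `n - m` parameters are indeterminates. -/
def sliceMatrix (h : m ≤ n) (A : Matrix (Fin m) (Fin n) ℂ) (i : Fin m) :
    Matrix (Fin m) (Fin n) (MvPolynomial (Fin (n - m)) ℂ) :=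
  member A (Fin.cons (MvPolynomial.C (-diagEntry h A i)) MvPolynomial.X)

/-- The coordinates `k_l` of the left kernel vector of `sliceMatrix h A i`, as polynomials in the
remaining parameters: `k_l = 0` for `l < i`, `k_i = 1`, and for `l > i` the `l`-th column of the
kernel equations is solved for `k_l`. -/
def kernelCoord (h : m ≤ n) (A : Matrix (Fin m) (Fin n) ℂ) (i : Fin m) (l : Fin m) :
    MvPolynomial (Fin (n - m)) ℂ :=
  if l < i then 0
  else if l = i then 1
  else MvPolynomial.C (1 / (diagEntry h A i - diagEntry h A l)) *
    ∑ p : Fin (l : ℕ), kernelCoord h A i ⟨p, p.isLt.trans l.isLt⟩ *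
      sliceMatrix h A i ⟨p, p.isLt.trans l.isLt⟩ (Fin.castLE h l)
termination_by (l : ℕ)
decreasing_by exact p.isLt

/-- The `n - m` equations in `n - m` variables: the kernel coordinates substituted in the kernel
equations of the last `n - m` columns. -/
def equation (h : m ≤ n) (A : Matrix (Fin m) (Fin n) ℂ) (i : Fin m) (c : Fin (n - m)) :
    MvPolynomial (Fin (n - m)) ℂ :=
  ∑ l : Fin m, kernelCoord h A i l *
    sliceMatrix h A i l ⟨m + (c : ℕ), by have := c.isLt; omega⟩

/-- The `i`-th piece, in the coordinates of the pencil: the first parameter is minus the `i`-th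
diagonal entry and the remaining ones solve the `i`-th system of equations. -/
def piece (h : m ≤ n) (A : Matrix (Fin m) (Fin n) ℂ) (i : Fin m) :
    Set (Fin (n - m + 1) → ℂ) :=
  {lam | lam 0 = -diagEntry h A i ∧
    ∀ c, MvPolynomial.eval (fun s : Fin (n - m) => lam s.succ) (equation h A i c) = 0}

/-- The ideal generated by the maximal minors of an `m × n` matrix (with `m ≤ n`). -/
def maximalMinorsIdeal {R : Type*} [CommRing R] (M : Matrix (Fin m) (Fin n) R) : Ideal R :=
  Ideal.span (Set.range fun f : Fin m ↪o Fin n => (M.submatrix id f).det)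

/-- A finite system of polynomial equations is a complete intersection if its zero scheme in affine
space is nonempty, of dimension the number of variables minus the number of equations.
(The Krull dimension of the zero ring is `⊥`, so the equality excludes the empty scheme.) -/
def IsCompleteIntersection {ι σ : Type*} [Fintype ι] [Fintype σ]
    (f : ι → MvPolynomial σ ℂ) : Prop :=
  ringKrullDim (MvPolynomial σ ℂ ⧸ Ideal.span (Set.range f)) + (Fintype.card ι : WithBot ℕ∞) =
    (Fintype.card σ : WithBot ℕ∞)

end MatrixPencil

end

/-!
Fix `i` and write `M = sliceMatrix h A i`, `k = kernelCoord h A i` and `d = n - m`.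

The row vector `k` is built so that `k M = (0, …, 0, F_{m+1}, …, F_n)`, the `F_c` being the
equations (`vecMul_kernelCoord_castLE`). The first `m` columns of `M` are upper triangular with a
single zero on the diagonal, in position `i`, so every vector killed by them is a multiple of `k`;
hence a member of the pencil with first parameter `-a_{i,i}` drops rank exactly where all `F_c`
vanish (`rank_member_lt_iff`). If the first parameter is no `-a_{i,i}`, the first `m` columns are
invertible and the rank is `m`. This gives both descriptions of the eigenvalue locus.

The ideals agree because of Cramer's rule: for a square submatrix `B` of `M` with `m` columns,
comparing the `i`-th entries in `k B adj(B) = det(B) k`, where `k_i = 1`, expresses `det B` as a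
combination of the entries of `k B`, which are zeros and `F_c`'s. If the columns of `B` are the first
`m` ones with the `i`-th replaced by column `c`, the result is `det B = F_c adj(B)_{i,i}`, and
`adj(B)_{i,i}` is the product of the nonzero constants `a_{l,l} - a_{i,i}`, `l ≠ i`.

For the complete intersection, the main point is that every variable is integral over `ℂ[F]`.
By the valuative criterion it suffices that a valuation `v` of the field of rational functions with
`v(F_c) ≤ 1` for all `c` has `v(x_s) ≤ 1` for all `s` (`valuation_le_one_of_banded`). Give `x_s`,
which sits on the `s`-th diagonal, the weight `s`, and suppose that `γ = max v(x_s)^{1/s} > 1`. Let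
`r` be the largest index where this maximum is attained, and `p` the largest index where
`v(k_p) / γ^p` is maximal. In the sum of the products `k_l M_{l,p+r}`, the term `l = p` then strictly
dominates all others, so the value of this sum is `v(k_p) γ^r`. This is nonzero, so `p + r` is not
among the first `m` columns, and it is then larger than `1`, so the sum is not one of the `F_c`
either: a contradiction.
Now `ℂ[x]` is integral over the subalgebra generated by the `d` polynomials `F_c`, so these form a
transcendence basis, and `y_c ↦ F_c` is an injective integral map `ℂ[y] → ℂ[x]`. By lying over, the
`F_c` generate a proper ideal; the quotient is integral over `ℂ`, hence of dimension `0`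
(`isCompleteIntersection_of_isIntegral`).
-/

namespace MatrixPencil

open MvPolynomial

variable {m n : ℕ}

/-! ### A criterion for complete intersections -/

/-- If the polynomial ring is integral over the subalgebra generated by as many polynomials as there
are variables, then these polynomials form a complete intersection. -/
theorem isCompleteIntersection_of_isIntegral {d : ℕ} (f : Fin d → MvPolynomial (Fin d) ℂ)
    (hX : ∀ s, IsIntegral (Algebra.adjoin ℂ (Set.range f)) (X s : MvPolynomial (Fin d) ℂ)) :
    IsCompleteIntersection f := by
  have hint : Algebra.IsIntegral (Algebra.adjoin ℂ (Set.range f)) (MvPolynomial (Fin d) ℂ) := by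
    refine ⟨fun p => ?_⟩
    induction p using MvPolynomial.induction_on with
    | C a =>
      exact isIntegral_algebraMap (R := Algebra.adjoin ℂ (Set.range f)) (x := algebraMap ℂ _ a)
    | add p q hp hq => exact hp.add hq
    | mul_X p s hp => exact hp.mul (hX s)
  have hbasis : IsTranscendenceBasis ℂ f := by
    refine Algebra.IsAlgebraic.isTranscendenceBasis_of_le_trdeg_of_finite ℂ f ?_
    rw [MvPolynomial.trdeg_of_isDomain, Cardinal.lift_uzero]
  let φ : MvPolynomial (Fin d) ℂ →+* MvPolynomial (Fin d) ℂ := (aeval f).toRingHom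
  have hφinj : Function.Injective φ := hbasis.1
  have hφint : φ.IsIntegral := by
    have h1 : (algebraMap (Algebra.adjoin ℂ (Set.range f)) (MvPolynomial (Fin d) ℂ)).IsIntegral :=
      hint.isIntegral
    have h2 : (hbasis.1.aevalEquiv.toRingEquiv.toRingHom).IsIntegral :=
      RingHom.isIntegral_of_surjective _ hbasis.1.aevalEquiv.surjective
    have h3 := RingHom.IsIntegral.trans _ _ h2 h1
    have h4 : φ = (algebraMap (Algebra.adjoin ℂ (Set.range f)) (MvPolynomial (Fin d) ℂ)).comp
        hbasis.1.aevalEquiv.toRingEquiv.toRingHom := RingHom.ext fun p =>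
      (hbasis.1.algebraMap_aevalEquiv p).symm
    rwa [h4]
  have hmap : (Ideal.span (Set.range (X : Fin d → MvPolynomial (Fin d) ℂ))).map φ =
      Ideal.span (Set.range f) := by
    rw [Ideal.map_span, ← Set.range_comp]
    congr 2
    ext s
    simp [φ]
  have hproper : Ideal.span (Set.range f) ≠ ⊤ := by
    rw [← hmap, ne_eq, Ideal.map_eq_top_iff φ hφinj hφint]
    refine ne_top_of_le_ne_top (RingHom.ker_ne_top (constantCoeff (R := ℂ) (σ := Fin d))) ?_
    rw [Ideal.span_le]
    rintro _ ⟨s, rfl⟩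
    exact constantCoeff_X ℂ s
  have : Nontrivial (MvPolynomial (Fin d) ℂ ⧸ Ideal.span (Set.range f)) :=
    Ideal.Quotient.nontrivial_iff.2 hproper
  have hquot : (algebraMap ℂ (MvPolynomial (Fin d) ℂ ⧸ Ideal.span (Set.range f))).IsIntegral := by
    have h1 := RingHom.IsIntegral.trans _ _ hφint
      (RingHom.isIntegral_of_surjective _
        (Ideal.Quotient.mk_surjective (I := Ideal.span (Set.range f))))
    -- modulo `f`, the map `φ` factors through the evaluation at the origin, so that integrality over
    -- `ℂ[y]` becomes integrality over `ℂ`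
    have h2 : (Ideal.Quotient.mk (Ideal.span (Set.range f))).comp φ =
        (algebraMap ℂ (MvPolynomial (Fin d) ℂ ⧸ Ideal.span (Set.range f))).comp
          constantCoeff := by
      ext s
      · simp [φ]
        rfl
      · simp only [RingHom.comp_apply, constantCoeff_X, map_zero]
        rw [Ideal.Quotient.eq_zero_iff_mem]
        exact Ideal.subset_span ⟨s, by simp [φ]⟩
    rw [h2] at h1
    exact RingHom.IsIntegral.tower_top _ _ h1
  have : Algebra.IsIntegral ℂ (MvPolynomial (Fin d) ℂ ⧸ Ideal.span (Set.range f)) := ⟨hquot⟩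
  have : Module.Finite ℂ (MvPolynomial (Fin d) ℂ ⧸ Ideal.span (Set.range f)) :=
    Algebra.IsIntegral.finite
  have : IsArtinianRing (MvPolynomial (Fin d) ℂ ⧸ Ideal.span (Set.range f)) :=
    IsArtinianRing.of_finite ℂ _
  have hdim : ringKrullDim (MvPolynomial (Fin d) ℂ ⧸ Ideal.span (Set.range f)) = 0 :=
    ringKrullDimZero_iff_ringKrullDim_eq_zero.1 inferInstance
  rw [IsCompleteIntersection, hdim, zero_add]

/-! ### Integrality through valuations -/

/-- The valuative criterion of integrality, for an element of a domain `P` and a subalgebra of `P`;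
the valuation rings are those of a field `K` containing `P`. -/
theorem isIntegral_of_forall_valuationSubring {P K : Type*} [CommRing P] [IsDomain P] [Field K]
    [Algebra P K] [FaithfulSMul P K] [Algebra ℂ P] (S : Subalgebra ℂ P) (x : P)
    (h : ∀ V : ValuationSubring K, (∀ y ∈ S, algebraMap P K y ∈ V) → algebraMap P K x ∈ V) :
    IsIntegral S x := by
  have hinj := FaithfulSMul.algebraMap_injective P K
  set R : Subring K := S.toSubring.map (algebraMap P K) with hR
  have hx : algebraMap P K x ∈ (integralClosure (Subring.closure (R : Set K)) K).toSubring := by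
    rw [← iInf_valuationSubring_superset]
    simp only [Subring.mem_iInf]
    intro V
    exact h V.1 fun y hy => V.2 ⟨y, hy, rfl⟩
  rw [Subring.closure_eq] at hx
  obtain ⟨p, hp, hpx⟩ : IsIntegral R (algebraMap P K x) := hx
  let e : S →+* R := ((algebraMap P K).comp S.val.toRingHom).codRestrict R
    fun y => ⟨y, y.2, rfl⟩
  have he : Function.Surjective e := by
    rintro ⟨_, y, hy, rfl⟩
    exact ⟨⟨y, hy⟩, rfl⟩
  obtain ⟨q, hq, -, hqm⟩ := Polynomial.lifts_and_natDegree_eq_and_monic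
    ((Polynomial.lifts_iff_coeff_lifts (f := e) p).2 fun _ => he _) hp
  refine ⟨q, hqm, hinj ?_⟩
  rw [Polynomial.hom_eval₂, map_zero, ← hpx, ← hq, Polynomial.eval₂_map]
  rfl

/-- Let `M` be upper triangular with entries of value at most `1` on the diagonal and, up to such
elements, `x s` on the `s`-th diagonal above it (`x s = 0` for `s > n - m`). If the entries of `k M`
have value at most `1`, the first `m` of them being zero, and some entry of `k` is `1`, then all
`x s` have value at most `1`. The `s`-th root of `v (x s)` is required to exist in the value group, as
`g s`, so that the weighted values of the `x s` can be compared with each other. -/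
theorem valuation_le_one_of_banded {K Γ₀ : Type*} [Field K] [LinearOrderedCommGroupWithZero Γ₀]
    (v : Valuation K Γ₀) {m n : ℕ} (h : m ≤ n) (M : Matrix (Fin m) (Fin n) K) (x : ℕ → K)
    (g : ℕ → Γ₀) (hg : ∀ s, 1 ≤ s → s ≤ n - m → g s ^ s = v (x s)) (hx : ∀ s, n - m < s → x s = 0)
    (hlow : ∀ (p : Fin m) (j : Fin n), (j : ℕ) < p → M p j = 0)
    (hdiag : ∀ (p : Fin m) (j : Fin n), (j : ℕ) = p → v (M p j) ≤ 1)
    (hup : ∀ (p : Fin m) (j : Fin n), (p : ℕ) < j → v (M p j - x (j - p)) ≤ 1)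
    (i : Fin m) (k : Fin m → K) (hk : k i = 1)
    (hzero : ∀ j : Fin n, (j : ℕ) < m → ∑ l, k l * M l j = 0)
    (hle : ∀ j : Fin n, v (∑ l, k l * M l j) ≤ 1) (s : ℕ) (hs : 1 ≤ s) :
    v (x s) ≤ 1 := by
  by_contra! hgt
  have hsd : s ≤ n - m := by
    by_contra! h'
    simp [hx s h'] at hgt
  -- the largest index `r` at which `g` attains its maximum `γ`
  obtain ⟨r, hr, hrmax⟩ := Finset.exists_max_image (Finset.Icc 1 (n - m))
    (fun s => toLex (g s, s)) ⟨s, Finset.mem_Icc.2 ⟨hs, hsd⟩⟩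
  simp only [Finset.mem_Icc, Prod.Lex.toLex_le_toLex] at hr hrmax
  set γ := g r with hγ
  have hγ1 : 1 < γ := by
    have h1 : 1 < g s := by
      by_contra! h'
      exact absurd (hg s hs hsd ▸ pow_le_one' h' s) hgt.not_ge
    rcases hrmax s ⟨hs, hsd⟩ with h' | h'
    · exact h1.trans h'
    · exact h1.trans_eq h'.1
  have hγ0 : 0 < γ := zero_lt_one.trans hγ1
  have hpos : ∀ a : ℕ, 0 < γ ^ a := fun a => pow_pos hγ0 a
  have hxle : ∀ s, 1 ≤ s → v (x s) ≤ γ ^ s := fun s h1 => by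
    by_cases h2 : s ≤ n - m
    · rw [← hg s h1 h2]
      refine pow_le_pow_left₀ zero_le ?_ s
      rcases hrmax s ⟨h1, h2⟩ with h' | h'
      exacts [h'.le, h'.1.le]
    · rw [hx s (by omega), map_zero]; exact zero_le
  have hxlt : ∀ s, r < s → v (x s) < γ ^ s := fun s h1 => by
    by_cases h2 : s ≤ n - m
    · rw [← hg s (by omega) h2]
      refine pow_lt_pow_left₀ ?_ zero_le (by omega)
      rcases hrmax s ⟨by omega, h2⟩ with h' | h'
      exacts [h', absurd h'.2 (by simpa using h1)]
    · rw [hx s (by omega), map_zero]; exact hpos s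
  have hMle : ∀ (q : Fin m) (j : Fin n), (q : ℕ) < j → v (M q j) ≤ γ ^ ((j : ℕ) - q) :=
    fun q j hq => by
      rw [← sub_add_cancel (M q j) (x (j - q))]
      exact v.map_add_le ((hup q j hq).trans (one_le_pow₀ hγ1.le)) (hxle _ (by omega))
  have hMlt : ∀ (q : Fin m) (j : Fin n), (q : ℕ) + r < j → v (M q j) < γ ^ ((j : ℕ) - q) :=
    fun q j hq => by
      rw [← sub_add_cancel (M q j) (x (j - q))]
      exact v.map_add_lt ((hup q j (by omega)).trans_lt (one_lt_pow₀ hγ1 (by omega)))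
        (hxlt _ (by omega))
  have hMeq : ∀ (q : Fin m) (j : Fin n), (j : ℕ) = q + r → v (M q j) = γ ^ r :=
    fun q j hq => by
      have hsub : (j : ℕ) - q = r := by omega
      have h1 := hup q j (by omega)
      rw [hsub] at h1
      rw [← sub_add_cancel (M q j) (x r), v.map_add_eq_of_lt_right, ← hg r hr.1 hr.2]
      rw [← hg r hr.1 hr.2]
      exact h1.trans_lt (one_lt_pow₀ hγ1 (by omega))
  -- the largest index `p` at which `v (k p) / γ ^ p` attains its maximum `κ`
  obtain ⟨p, -, hpmax⟩ := Finset.exists_max_image Finset.univ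
    (fun q : Fin m => toLex (v (k q) / γ ^ (q : ℕ), q)) ⟨i, Finset.mem_univ i⟩
  simp only [Finset.mem_univ, true_implies, Prod.Lex.toLex_le_toLex] at hpmax
  set κ := v (k p) / γ ^ (p : ℕ) with hκ
  have hvp : v (k p) = κ * γ ^ (p : ℕ) := by rw [hκ, div_mul_cancel₀ _ (hpos _).ne']
  have hκi : 1 ≤ κ * γ ^ (i : ℕ) := by
    rw [← div_le_iff₀ (hpos _), ← map_one v, ← hk]
    rcases hpmax i with h' | h'
    exacts [h'.le, h'.1.le]
  have hκ0 : 0 < κ := by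
    rcases (zero_le (a := κ)).eq_or_lt with h' | h'
    · rw [← h', zero_mul] at hκi
      exact absurd hκi (by simp)
    · exact h'
  have hkle : ∀ q, v (k q) ≤ κ * γ ^ (q : ℕ) := fun q => by
    rw [← div_le_iff₀ (hpos _)]
    rcases hpmax q with h' | h'
    exacts [h'.le, h'.1.le]
  have hklt : ∀ q, p < q → v (k q) < κ * γ ^ (q : ℕ) := fun q hq => by
    rw [← div_lt_iff₀ (hpos _)]
    rcases hpmax q with h' | h'
    exacts [h', absurd h'.2 (not_le.2 hq)]
  have hlt : (p : ℕ) + r < n := by have := p.2; omega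
  set j : Fin n := ⟨p + r, hlt⟩ with hj
  have hjv : (j : ℕ) = p + r := rfl
  have hB : v (k p * M p j) = κ * γ ^ (j : ℕ) := by
    rw [map_mul, hMeq p j rfl, hvp, hjv, pow_add, mul_assoc]
  -- column `p + r` exists since `p < m` and `r ≤ n - m`; its dominant term is the one of row `p`
  have hsum : v (∑ l, k l * M l j) = κ * γ ^ (j : ℕ) := by
    rw [← hB]
    refine v.map_sum_eq_of_lt (Finset.mem_univ p) fun q hq => ?_
    rw [Finset.mem_sdiff, Finset.mem_singleton] at hq
    rw [hB, map_mul]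
    rcases lt_trichotomy (j : ℕ) q with h1 | h1 | h1
    · rw [hlow q j h1, map_zero, mul_zero]
      exact mul_pos hκ0 (hpos _)
    · have hpq : p < q := Fin.lt_def.2 (by omega)
      rw [h1]
      exact (mul_le_of_le_one_right' (hdiag q j h1)).trans_lt (hklt q hpq)
    · have hsplit : κ * γ ^ (j : ℕ) = κ * γ ^ (q : ℕ) * γ ^ ((j : ℕ) - q) := by
        rw [mul_assoc, ← pow_add]; congr 2; omega
      rw [hsplit]
      rcases lt_or_gt_of_ne hq.2 with h2 | h2
      · exact mul_lt_mul_of_le_of_lt_of_nonneg_of_pos (hkle q)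
          (hMlt q j (by have := Fin.lt_def.1 h2; omega)) zero_le (mul_pos hκ0 (hpos _))
      · exact mul_lt_mul_of_lt_of_le_of_nonneg_of_pos (hklt q h2) (hMle q j h1) zero_le (hpos _)
  by_cases hjm : (j : ℕ) < m
  · rw [hzero j hjm, map_zero] at hsum
    exact (mul_pos hκ0 (hpos _)).ne hsum
  · have hij : (i : ℕ) < j := by have := i.2; omega
    have : κ * γ ^ (i : ℕ) < κ * γ ^ (j : ℕ) :=
      mul_lt_mul_of_pos_left (pow_lt_pow_right₀ hγ1 hij) hκ0
    exact absurd (hle j) (not_le.2 (hκi.trans_lt (this.trans_eq hsum.symm)))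

/-! ### Ideals of maximal minors -/

section Minors

variable {R : Type*} [CommRing R]

/-- The `i`-th entry of the identity `k B adj(B) = det(B) k`, for `k i = 1`. -/
theorem det_eq_sum_vecMul_mul_adjugate {ι : Type*} [Fintype ι] [DecidableEq ι]
    (B : Matrix ι ι R) (k : ι → R) {i : ι} (hk : k i = 1) :
    B.det = ∑ c, Matrix.vecMul k B c * B.adjugate c i := by
  have h1 : Matrix.vecMul (Matrix.vecMul k B) B.adjugate = B.det • k := by
    rw [Matrix.vecMul_vecMul, Matrix.mul_adjugate, Matrix.vecMul_smul, Matrix.vecMul_one]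
  have h2 := congrFun h1 i
  rw [Pi.smul_apply, hk, smul_eq_mul, mul_one] at h2
  exact h2.symm

/-- The ideal of maximal minors contains the minors with columns in any order and with repeated
columns. -/
theorem det_submatrix_mem_maximalMinorsIdeal (M : Matrix (Fin m) (Fin n) R)
    (f : Fin m → Fin n) : (M.submatrix id f).det ∈ maximalMinorsIdeal M := by
  by_cases hf : Function.Injective f
  · have hmono : StrictMono (f ∘ Tuple.sort f) :=
      (Tuple.monotone_sort f).strictMono_of_injective (hf.comp (Tuple.sort f).injective)
    have h1 : (M.submatrix id (f ∘ Tuple.sort f)).det ∈ maximalMinorsIdeal M :=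
      Ideal.subset_span ⟨OrderEmbedding.ofStrictMono _ hmono, rfl⟩
    have h2 := Matrix.det_permute' (Tuple.sort f) (M.submatrix id f)
    rw [Matrix.submatrix_submatrix, Function.id_comp] at h2
    rw [h2] at h1
    exact (Ideal.unit_mul_mem_iff_mem _ ((Units.isUnit _).map (Int.castRingHom R))).1 h1
  · obtain ⟨a, b, hab, hne⟩ := by simpa [Function.Injective] using hf
    rw [Matrix.det_zero_of_column_eq hne fun l => by simp [hab]]
    exact zero_mem _

theorem maximalMinorsIdeal_le (M : Matrix (Fin m) (Fin n) R) (k : Fin m → R) {i : Fin m}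
    (hk : k i = 1) {I : Ideal R} (hI : ∀ j, Matrix.vecMul k M j ∈ I) :
    maximalMinorsIdeal M ≤ I := by
  rw [maximalMinorsIdeal, Ideal.span_le]
  rintro _ ⟨f, rfl⟩
  simp only [SetLike.mem_coe]
  rw [det_eq_sum_vecMul_mul_adjugate _ k hk]
  exact Ideal.sum_mem _ fun c _ => Ideal.mul_mem_right _ _ (hI (f c))

/-- The converse of `maximalMinorsIdeal_le`, for a matrix whose first `m` columns are upper
triangular, with units on the diagonal outside the `i`-th position, and are killed by `k`. -/
theorem vecMul_mem_maximalMinorsIdeal (h : m ≤ n) (M : Matrix (Fin m) (Fin n) R) (k : Fin m → R)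
    {i : Fin m} (hk : k i = 1) (hlow : ∀ (p : Fin m) (j : Fin n), (j : ℕ) < p → M p j = 0)
    (hdiag : ∀ l, l ≠ i → IsUnit (M l (Fin.castLE h l)))
    (hker : ∀ l : Fin m, Matrix.vecMul k M (Fin.castLE h l) = 0) (j : Fin n) :
    Matrix.vecMul k M j ∈ maximalMinorsIdeal M := by
  have hB := det_submatrix_mem_maximalMinorsIdeal M (Function.update (Fin.castLE h) i j)
  set B := M.submatrix id (Function.update (Fin.castLE h) i j) with hBdef
  have hcol : ∀ c, Matrix.vecMul k B c =
      Matrix.vecMul k M (Function.update (Fin.castLE h) i j c) := fun c => rfl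
  rw [det_eq_sum_vecMul_mul_adjugate B k hk, Finset.sum_eq_single i
    (fun c _ hc => by rw [hcol, Function.update_of_ne hc, hker, zero_mul]) (by simp), hcol,
    Function.update_self] at hB
  -- `adj(B)_{i,i}` does not see column `i` of `B`, which may be replaced by a unit vector; the result
  -- is upper triangular
  have hadj : IsUnit (B.adjugate i i) := by
    have h1 : B.adjugate i i = (B.updateCol i (Pi.single i 1)).det := by
      rw [← Matrix.transpose_apply B.adjugate, Matrix.adjugate_transpose,
        Matrix.adjugate_apply, ← Matrix.det_transpose, Matrix.updateRow_transpose,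
        Matrix.transpose_transpose]
    rw [h1, Matrix.det_of_isUpperTriangular]
    · rw [IsUnit.prod_univ_iff]
      intro l
      by_cases hl : l = i
      · subst hl; simp
      · rw [Matrix.updateCol_ne hl]
        simpa [hBdef, hl] using hdiag l hl
    · intro p q hpq
      change q < p at hpq
      by_cases hq : q = i
      · subst hq
        rw [Matrix.updateCol_self, Pi.single_eq_of_ne hpq.ne']
      · rw [Matrix.updateCol_ne hq]
        simpa [hBdef, hq] using hlow p (Fin.castLE h q) hpq
  exact (Ideal.mul_unit_mem_iff_mem _ hadj).1 hB

end Minors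

/-! ### Left kernel vectors of upper-triangular rectangular matrices -/

/-- Forward substitution in the first `m` columns. -/
theorem eq_zero_of_vecMul_eq_zero {R : Type*} [CommRing R] [NoZeroDivisors R] (h : m ≤ n)
    (M : Matrix (Fin m) (Fin n) R) (hlow : ∀ (p : Fin m) (j : Fin n), (j : ℕ) < p → M p j = 0)
    (v : Fin m → R) (hv : ∀ l, M l (Fin.castLE h l) = 0 → v l = 0)
    (hker : ∀ l : Fin m, Matrix.vecMul v M (Fin.castLE h l) = 0) : v = 0 := by
  funext l
  induction l using WellFoundedLT.induction with
  | _ l ih =>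
    have h1 := hker l
    rw [Matrix.vecMul, dotProduct, Finset.sum_eq_single l _ (by simp)] at h1
    · exact (mul_eq_zero.1 h1).elim id (hv l)
    · intro p _ hp
      rcases lt_or_gt_of_ne hp with h2 | h2
      · rw [ih p h2, Pi.zero_apply, zero_mul]
      · rw [hlow p _ h2, mul_zero]

theorem rank_lt_iff_exists_vecMul_eq_zero {K : Type*} [Field K] (M : Matrix (Fin m) (Fin n) K) :
    M.rank < m ↔ ∃ v, v ≠ 0 ∧ Matrix.vecMul v M = 0 := by
  have h1 : M.rank = m ↔ LinearIndependent K M.row := by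
    rw [Matrix.rank_eq_finrank_span_row, linearIndependent_iff_card_eq_finrank_span,
      Fintype.card_fin, eq_comm]
    rfl
  rw [M.rank_le_height.lt_iff_ne, ne_eq, h1, ← Matrix.vecMul_injective_iff, ← not_iff_not,
    not_not]
  change Function.Injective (Matrix.vecMulLinear M) ↔ _
  rw [injective_iff_map_eq_zero]
  push Not
  simp only [Matrix.vecMulLinear_apply, not_imp_not]

/-! ### The members of the pencil -/

section Member
variable {R : Type*} [CommRing R] [Algebra ℂ R] (A : Matrix (Fin m) (Fin n) ℂ)
  (lam : Fin (n - m + 1) → R)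

theorem member_apply (p : Fin m) (j : Fin n) : member A lam p j =
    algebraMap ℂ R (A p j) + ∑ s : Fin (n - m + 1), if (j : ℕ) = p + s then lam s else 0 := by
  simp [member, diagonalMatrix, Matrix.sum_apply]

theorem member_apply_of_eq_add {p : Fin m} {j : Fin n} (s : Fin (n - m + 1))
    (hj : (j : ℕ) = p + s) : member A lam p j = algebraMap ℂ R (A p j) + lam s := by
  rw [member_apply, Finset.sum_eq_single s _ (by simp), if_pos hj]
  intro t _ ht
  exact if_neg fun h' => ht (Fin.ext (by omega))

theorem member_apply_of_lt {p : Fin m} {j : Fin n} (hj : (j : ℕ) < p) :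
    member A lam p j = algebraMap ℂ R (A p j) := by
  rw [member_apply, Finset.sum_eq_zero fun s _ => if_neg (by omega), add_zero]

theorem member_apply_of_gt {p : Fin m} {j : Fin n} (hj : (p : ℕ) + (n - m) < j) :
    member A lam p j = algebraMap ℂ R (A p j) := by
  rw [member_apply, Finset.sum_eq_zero fun s _ => if_neg (by have := s.2; omega), add_zero]

theorem member_apply_diag (h : m ≤ n) (p : Fin m) :
    member A lam p (Fin.castLE h p) = algebraMap ℂ R (diagEntry h A p) + lam 0 :=
  member_apply_of_eq_add A lam 0 (by simp)

/-- Specializing the parameters commutes with forming the member of the pencil. -/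
theorem map_member {R' : Type*} [CommRing R'] [Algebra ℂ R'] (φ : R →ₐ[ℂ] R') :
    (member A lam).map φ = member A (φ ∘ lam) := by
  ext p j
  simp only [Matrix.map_apply, member_apply, map_add, AlgHom.commutes, map_sum, apply_ite φ,
    map_zero, Function.comp_apply]

theorem mem_eigenvalueLocus_iff {N : Matrix (Fin m) (Fin n) ℂ} :
    N ∈ eigenvalueLocus A (standardDiagonalSubspace m n) ↔
      ∃ lam : Fin (n - m + 1) → ℂ, member A lam = N ∧ N.rank < m := by
  rw [eigenvalueLocus, Set.mem_ofPred_eq, standardDiagonalSubspace,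
    Submodule.mem_span_range_iff_exists_fun, exists_and_right]
  refine and_congr_left fun _ => exists_congr fun lam => ?_
  rw [eq_sub_iff_add_eq, add_comm]
  rfl

end Member

/-! ### The slices of the pencil through the diagonal entries -/

section Slice
variable (h : m ≤ n) (A : Matrix (Fin m) (Fin n) ℂ) (i : Fin m)

theorem sliceMatrix_apply_of_lt (hA : ∀ (i : Fin m) (j : Fin n), (j : ℕ) < (i : ℕ) → A i j = 0)
    (p : Fin m) (j : Fin n) (hj : (j : ℕ) < p) : sliceMatrix h A i p j = 0 := by
  rw [sliceMatrix, member_apply_of_lt _ _ hj, hA p j hj, map_zero]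

theorem sliceMatrix_apply_diag (p : Fin m) :
    sliceMatrix h A i p (Fin.castLE h p) = C (diagEntry h A p - diagEntry h A i) := by
  rw [sliceMatrix, member_apply_diag, Fin.cons_zero, sub_eq_add_neg, C_add]
  rfl

/-- The variable on the `s`-th diagonal above the main one, for `s ≥ 1`, and zero for `s > d`, where
the pencil has no variable. The indeterminates are numbered from `0`, which shifts the index. The
value at `s = 0` is meaningless and not used. -/
noncomputable def diagonalVariable (d s : ℕ) : MvPolynomial (Fin d) ℂ :=
  if hs : s - 1 < d then X ⟨s - 1, hs⟩ else 0

theorem sliceMatrix_apply_of_gt {p : Fin m} {j : Fin n} (hj : (p : ℕ) < j) :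
    sliceMatrix h A i p j = C (A p j) + diagonalVariable (n - m) (j - p) := by
  rw [diagonalVariable]
  split_ifs with hs
  · rw [sliceMatrix, member_apply_of_eq_add _ _ (Fin.succ ⟨j - p - 1, hs⟩)
      (by rw [Fin.val_succ]; dsimp only; omega), Fin.cons_succ]
    rfl
  · rw [sliceMatrix, member_apply_of_gt _ _ (by omega), add_zero]
    rfl

theorem sliceMatrix_map_eval (lam : Fin (n - m + 1) → ℂ) (h0 : lam 0 = -diagEntry h A i) :
    (sliceMatrix h A i).map (eval fun s => lam s.succ) = member A lam := by
  have h1 := map_member A (Fin.cons (C (-diagEntry h A i)) X) (aeval fun s => lam (Fin.succ s))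
  have h2 : (aeval fun s => lam (Fin.succ s)) ∘ Fin.cons (C (-diagEntry h A i)) X = lam :=
    funext (Fin.cases (by simp [h0]) (by simp))
  rw [h2] at h1
  rw [sliceMatrix, ← h1, ← coe_aeval_eq_eval]
  rfl

theorem kernelCoord_self : kernelCoord h A i i = 1 := by
  rw [kernelCoord]; simp

theorem kernelCoord_of_lt {l : Fin m} (hl : l < i) : kernelCoord h A i l = 0 := by
  rw [kernelCoord, if_pos hl]

/-- The vector `kernelCoord` solves the kernel equations of the first `m` columns. -/
theorem vecMul_kernelCoord_castLE
    (hA : ∀ (i : Fin m) (j : Fin n), (j : ℕ) < (i : ℕ) → A i j = 0)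
    (hdiag : Function.Injective (diagEntry h A)) (l : Fin m) :
    Matrix.vecMul (kernelCoord h A i) (sliceMatrix h A i) (Fin.castLE h l) = 0 := by
  have hsplit : Matrix.vecMul (kernelCoord h A i) (sliceMatrix h A i) (Fin.castLE h l) =
      ∑ p : Fin (l : ℕ), kernelCoord h A i ⟨p, p.isLt.trans l.isLt⟩ *
        sliceMatrix h A i ⟨p, p.isLt.trans l.isLt⟩ (Fin.castLE h l) +
      kernelCoord h A i l * C (diagEntry h A l - diagEntry h A i) := by
    rw [Matrix.vecMul, dotProduct, ← Finset.sum_erase_add _ _ (Finset.mem_univ l),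
      sliceMatrix_apply_diag]
    congr 1
    symm
    refine Finset.sum_of_injOn (fun p : Fin (l : ℕ) => (⟨p, p.isLt.trans l.isLt⟩ : Fin m))
      (fun a _ b _ hab => Fin.ext (Fin.mk.inj hab)) (fun p _ => ?_) (fun q hq hq' => ?_)
      fun _ _ => rfl
    · have := p.2
      simp [Fin.ext_iff, this.ne]
    · have h1 : ¬ (q : ℕ) < l := fun h2 => hq' ⟨⟨q, h2⟩, by simp, rfl⟩
      have h2 : (q : ℕ) ≠ l := fun h3 => by simp [Fin.ext h3] at hq
      rw [sliceMatrix_apply_of_lt h A i hA q _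
        (by rw [Fin.val_castLE]; omega), mul_zero]
  rw [hsplit]
  rcases lt_trichotomy l i with hl | rfl | hl
  · rw [kernelCoord_of_lt h A i hl, zero_mul, add_zero]
    exact Finset.sum_eq_zero fun p _ => by
      rw [kernelCoord_of_lt h A i (lt_trans (Fin.lt_def.2 p.2) hl), zero_mul]
  · rw [sub_self, C_0, mul_zero, add_zero]
    exact Finset.sum_eq_zero fun p _ => by
      rw [kernelCoord_of_lt h A l (Fin.lt_def.2 p.2), zero_mul]
  · have hne : diagEntry h A i - diagEntry h A l ≠ 0 :=
      sub_ne_zero.2 fun h1 => hl.ne (hdiag h1)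
    rw [kernelCoord.eq_def h A i l, if_neg hl.not_gt, if_neg hl.ne', mul_right_comm, ← C_mul,
      ← neg_sub (diagEntry h A i), mul_neg, one_div_mul_cancel hne, C_neg, C_1]
    ring

theorem vecMul_kernelCoord_add (c : Fin (n - m)) :
    Matrix.vecMul (kernelCoord h A i) (sliceMatrix h A i)
      ⟨m + (c : ℕ), by have := c.isLt; omega⟩ = equation h A i c := rfl

/-- All entries of `k M` are equations or zero. The container `T` is an ideal, a subalgebra or a
kernel in the applications. -/
theorem vecMul_kernelCoord_mem {S : Type*} [SetLike S (MvPolynomial (Fin (n - m)) ℂ)]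
    [ZeroMemClass S (MvPolynomial (Fin (n - m)) ℂ)] (T : S)
    (hA : ∀ (i : Fin m) (j : Fin n), (j : ℕ) < (i : ℕ) → A i j = 0)
    (hdiag : Function.Injective (diagEntry h A)) (hT : ∀ c, equation h A i c ∈ T) (j : Fin n) :
    Matrix.vecMul (kernelCoord h A i) (sliceMatrix h A i) j ∈ T := by
  by_cases hj : (j : ℕ) < m
  · have h1 := vecMul_kernelCoord_castLE h A i hA hdiag ⟨j, hj⟩
    have h2 : Fin.castLE h ⟨j, hj⟩ = j := rfl
    rw [h2] at h1
    rw [h1]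
    exact zero_mem T
  · have h1 := vecMul_kernelCoord_add h A i ⟨j - m, by omega⟩
    have h2 : (⟨m + (j - m), by omega⟩ : Fin n) = j := Fin.ext (by simp; omega)
    simp only [h2] at h1
    rw [h1]
    exact hT _

theorem maximalMinorsIdeal_sliceMatrix
    (hA : ∀ (i : Fin m) (j : Fin n), (j : ℕ) < (i : ℕ) → A i j = 0)
    (hdiag : Function.Injective (diagEntry h A)) :
    maximalMinorsIdeal (sliceMatrix h A i) = Ideal.span (Set.range (equation h A i)) := by
  apply le_antisymm
  · exact maximalMinorsIdeal_le _ _ (kernelCoord_self h A i) fun j =>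
      vecMul_kernelCoord_mem h A i _ hA hdiag (fun c => Ideal.subset_span (Set.mem_range_self c)) j
  · rw [Ideal.span_le]
    rintro _ ⟨c, rfl⟩
    rw [SetLike.mem_coe, ← vecMul_kernelCoord_add]
    refine vecMul_mem_maximalMinorsIdeal h _ _ (kernelCoord_self h A i)
      (sliceMatrix_apply_of_lt h A i hA) (fun l hl => ?_)
      (vecMul_kernelCoord_castLE h A i hA hdiag) _
    rw [sliceMatrix_apply_diag]
    exact (IsUnit.mk0 _ (sub_ne_zero.2 fun h1 => hl (hdiag h1))).map C

theorem isCompleteIntersection_equation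
    (hA : ∀ (i : Fin m) (j : Fin n), (j : ℕ) < (i : ℕ) → A i j = 0)
    (hdiag : Function.Injective (diagEntry h A)) :
    IsCompleteIntersection (equation h A i) := by
  refine isCompleteIntersection_of_isIntegral _ fun s => ?_
  set S := Algebra.adjoin ℂ (Set.range (equation h A i))
  refine isIntegral_of_forall_valuationSubring
    (K := FractionRing (MvPolynomial (Fin (n - m)) ℂ)) S _ fun V hV => ?_
  set ι := algebraMap (MvPolynomial (Fin (n - m)) ℂ)
    (FractionRing (MvPolynomial (Fin (n - m)) ℂ))
  have hN : (n - m).factorial ≠ 0 := (n - m).factorial_ne_zero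
  -- raising the valuation to the power `(n - m)!` makes the roots of order `s ≤ n - m` available
  set w := V.valuation.map (powMonoidWithZeroHom hN) fun a b hab => pow_le_pow_left' hab _
  have hw : ∀ y, w y = V.valuation y ^ (n - m).factorial := fun y => rfl
  have hwle : ∀ y ∈ S, w (ι y) ≤ 1 := fun y hy =>
    pow_le_one' ((V.valuation_le_one_iff _).2 (hV y hy)) _
  have hwC : ∀ a : ℂ, w (ι (C a)) ≤ 1 := fun a => hwle _ (S.algebraMap_mem a)
  have hmul : ∀ j, ∑ l, ι (kernelCoord h A i l) * (sliceMatrix h A i).map ι l j =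
      ι (Matrix.vecMul (kernelCoord h A i) (sliceMatrix h A i) j) := fun j => by
    simp [Matrix.vecMul, dotProduct]
  have hfin := valuation_le_one_of_banded w h ((sliceMatrix h A i).map ι)
    (fun s => ι (diagonalVariable (n - m) s))
    (fun s => V.valuation (ι (diagonalVariable (n - m) s)) ^ ((n - m).factorial / s))
    (fun s hs hs' => ?_) (fun s hs => ?_) (fun p j hj => ?_) (fun p j hj => ?_) (fun p j hj => ?_)
    i (fun l => ι (kernelCoord h A i l)) ?_ (fun j hj => ?_) (fun j => ?_) (s + 1) (by omega)
  · rw [hw, pow_le_one_iff_of_nonneg zero_le hN, V.valuation_le_one_iff] at hfin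
    simpa [diagonalVariable] using hfin
  · rw [hw, ← pow_mul, Nat.div_mul_cancel (Nat.dvd_factorial hs hs')]
  · rw [diagonalVariable, dif_neg (by omega), map_zero]
  · rw [Matrix.map_apply, sliceMatrix_apply_of_lt h A i hA p j hj, map_zero]
  · have h1 : j = Fin.castLE h p := Fin.ext hj
    rw [h1, Matrix.map_apply, sliceMatrix_apply_diag]
    exact hwC _
  · rw [Matrix.map_apply, sliceMatrix_apply_of_gt h A i hj, map_add, add_sub_cancel_right]
    exact hwC _
  · rw [kernelCoord_self, map_one]
  · rw [hmul]
    have h1 := vecMul_kernelCoord_castLE h A i hA hdiag ⟨j, hj⟩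
    have h2 : Fin.castLE h ⟨j, hj⟩ = j := rfl
    rw [← h2, h1, map_zero]
  · rw [hmul]
    exact hwle _ (vecMul_kernelCoord_mem h A i S hA hdiag
      (fun c => Algebra.subset_adjoin ⟨c, rfl⟩) j)

theorem rank_member_lt_iff
    (hA : ∀ (i : Fin m) (j : Fin n), (j : ℕ) < (i : ℕ) → A i j = 0)
    (hdiag : Function.Injective (diagEntry h A)) (lam : Fin (n - m + 1) → ℂ)
    (h0 : lam 0 = -diagEntry h A i) :
    (member A lam).rank < m ↔
      ∀ c, eval (fun s : Fin (n - m) => lam s.succ) (equation h A i c) = 0 := by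
  set ev := eval (fun s : Fin (n - m) => lam s.succ)
  set k : Fin m → ℂ := fun l => ev (kernelCoord h A i l)
  have hki : k i = 1 := by simp only [k, kernelCoord_self, map_one]
  have hk : ∀ j, Matrix.vecMul k (member A lam) j =
      ev (Matrix.vecMul (kernelCoord h A i) (sliceMatrix h A i) j) := fun j => by
    rw [← sliceMatrix_map_eval h A i lam h0]
    simp [Matrix.vecMul, dotProduct, k, ev]
  have hlow : ∀ (p : Fin m) (j : Fin n), (j : ℕ) < p → member A lam p j = 0 := fun p j hj => by
    rw [member_apply_of_lt _ _ hj, hA p j hj, map_zero]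
  rw [rank_lt_iff_exists_vecMul_eq_zero]
  constructor
  · rintro ⟨v, hv0, hv⟩ c
    have hvk : v - v i • k = 0 := by
      refine eq_zero_of_vecMul_eq_zero h (member A lam) hlow _ (fun l hl => ?_) fun l => ?_
      · rw [member_apply_diag, h0, ← sub_eq_add_neg, sub_eq_zero] at hl
        rw [hdiag hl]
        simp [hki]
      · rw [Matrix.sub_vecMul, Matrix.smul_vecMul, hv, Pi.sub_apply, Pi.smul_apply, hk,
          vecMul_kernelCoord_castLE h A i hA hdiag]
        simp
    rw [sub_eq_zero] at hvk
    have hvi : v i ≠ 0 := fun h1 => hv0 (by rw [hvk, h1, zero_smul])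
    rw [hvk, Matrix.smul_vecMul, smul_eq_zero_iff_right hvi] at hv
    rw [← vecMul_kernelCoord_add, ← hk, hv, Pi.zero_apply]
  · intro hc
    refine ⟨k, fun h1 => by simp [h1] at hki, funext fun j => ?_⟩
    rw [hk]
    exact vecMul_kernelCoord_mem h A i (RingHom.ker ev) hA hdiag hc j

theorem exists_eq_neg_diagEntry_of_rank_lt
    (hA : ∀ (i : Fin m) (j : Fin n), (j : ℕ) < (i : ℕ) → A i j = 0)
    (lam : Fin (n - m + 1) → ℂ) (hr : (member A lam).rank < m) :
    ∃ i, lam 0 = -diagEntry h A i := by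
  by_contra! hne
  obtain ⟨v, hv0, hv⟩ := (rank_lt_iff_exists_vecMul_eq_zero _).1 hr
  refine hv0 (eq_zero_of_vecMul_eq_zero h (member A lam) (fun p j hj => ?_) v (fun l hl => ?_)
    fun l => by rw [hv, Pi.zero_apply])
  · rw [member_apply_of_lt _ _ hj, hA p j hj, map_zero]
  · rw [member_apply_diag] at hl
    exact absurd (eq_neg_of_add_eq_zero_right hl) (hne l)

theorem piece_eq
    (hA : ∀ (i : Fin m) (j : Fin n), (j : ℕ) < (i : ℕ) → A i j = 0)
    (hdiag : Function.Injective (diagEntry h A)) :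
    piece h A i = {lam : Fin (n - m + 1) → ℂ |
      member A lam ∈ eigenvalueLocus A (standardDiagonalSubspace m n) ∧
        lam 0 = -diagEntry h A i} := by
  ext lam
  have hmem : member A lam ∈ eigenvalueLocus A (standardDiagonalSubspace m n) ↔
      (member A lam).rank < m := by
    rw [mem_eigenvalueLocus_iff]
    exact ⟨fun ⟨_, _, h1⟩ => h1, fun h1 => ⟨lam, rfl, h1⟩⟩
  change _ ∧ _ ↔ _ ∧ _
  rw [hmem, and_comm]
  exact and_congr_left fun h0 => (rank_member_lt_iff h A i hA hdiag lam h0).symm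

end Slice
end MatrixPencil

theorem theorem1 {m n : ℕ} (h : m ≤ n) (A : Matrix (Fin m) (Fin n) ℂ)
    (hA : ∀ (i : Fin m) (j : Fin n), (j : ℕ) < (i : ℕ) → A i j = 0)
    (hdiag : Function.Injective fun i : Fin m => A i (Fin.castLE h i)) :
    MatrixPencil.eigenvalueLocus A (MatrixPencil.standardDiagonalSubspace m n) =
        ⋃ i : Fin m, MatrixPencil.member A '' MatrixPencil.piece h A i ∧
    ∀ i : Fin m,
      MatrixPencil.piece h A i =
          {lam : Fin (n - m + 1) → ℂ |
            MatrixPencil.member A lam ∈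
                MatrixPencil.eigenvalueLocus A (MatrixPencil.standardDiagonalSubspace m n) ∧
              lam 0 = -A i (Fin.castLE h i)} ∧
      MatrixPencil.maximalMinorsIdeal (MatrixPencil.sliceMatrix h A i) =
          Ideal.span (Set.range (MatrixPencil.equation h A i)) ∧
      MatrixPencil.IsCompleteIntersection (MatrixPencil.equation h A i) := by
  refine ⟨?_, fun i => ⟨MatrixPencil.piece_eq h A i hA hdiag,
    MatrixPencil.maximalMinorsIdeal_sliceMatrix h A i hA hdiag,
    MatrixPencil.isCompleteIntersection_equation h A i hA hdiag⟩⟩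
  ext N
  simp only [Set.mem_iUnion, Set.mem_image, MatrixPencil.piece_eq h A _ hA hdiag]
  constructor
  · intro hN
    obtain ⟨lam, rfl, hr⟩ := (MatrixPencil.mem_eigenvalueLocus_iff A).1 hN
    obtain ⟨i, hi⟩ := MatrixPencil.exists_eq_neg_diagEntry_of_rank_lt h A hA lam hr
    exact ⟨i, lam, ⟨hN, hi⟩, rfl⟩
  · rintro ⟨i, lam, ⟨hN, -⟩, rfl⟩
    exact hN
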